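/- Let $k$ be an algebraically closed field, $R=k[\![x_1,\dots,x_n]\!]$ with maximal ideal $\mathfrak m$, and let $S=k[y_1,\dots,y_n]$ be the $R$-module given by contraction: $x^\alpha\circ y^\beta=y^{\beta-\alpha}$ if $\beta\ge\alpha$, and $0$ otherwise. Let $A=R/I\neq 0$ be an Artin local ring with socle degree $s$ (the largest $j$ with $\mathfrak m^j\not\subseteq I$), and let $I^\perp=\{G\in S: I\circ G=0\}$. For an ideal $K$ of $R$ put $\int_K I^\perp=\{G\in S: K\circ G\subseteq I^\perp\}$. For $F\in S$ let $\langle F\rangle$ be the $R$-submodule generated by $F$; the ring $R/\operatorname{Ann}_R F$ is called a Gorenstein cover of $A$ of colength $\ell(R/\operatorname{Ann}_R F)-\ell(A)$ if $I^\perp\subseteq\langle F\rangle$. The Gorenstein colength $\operatorname{gcl}(A)$ is the minimal colength of a Gorenstein cover of $A$. Assume $\operatorname{gcl}(A)>1$. Choose polynomials such that $b_1,\dots,b_t$ is a $k$-basis of $I^\perp$, $b_1,\dots,b_t,F_1,\dots,F_{h_1}$ is a $k$-basis of $\int_{\mathfrak m}I^\perp$, and $b_1,\dots,b_t,F_1,\dots,F_{h_1},G_1,\dots,G_{h_2}$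 is a $k$-basis of $\int_{\mathfrak m^2}I^\perp$. Put $H=\sum_i\alpha_iF_i+\sum_i\beta_iG_i$ and write $$x_l\circ H=\sum_{j=1}^t\mu_l^jb_j+\sum_{j=1}^{h_1}\rho_l^jF_j,\qquad x^\theta\circ H=\sum_{j=1}^t\varsigma^j_\theta b_j\quad(|\theta|\ge 2),$$ where $\mu_l^j,\rho_l^j,\varsigma_\theta^j$ are linear forms in $\alpha,\beta$. For $v=(v_1,\dots,v_n)$ let: * $B_H=(\rho_l^j)_{1\le l\le n,\,1\le j\le h_1}$, and let $\mathfrak b\subseteq k[\alpha,\beta]$ be the ideal generated by its minors of order $2$; * $C_{H,v}=(B_H\mid v)$ be $B_H$ with the extra column $v$, and let $\mathfrak c\subseteq k[\alpha,\beta,v]$ be the ideal generated by its minors of order $2$; * $U_{H,v}$ be the matrix with $t$ columns whose rows are $(v_l\mu_m^j-v_m\mu_l^j)_{1\le j\le t}$ for $1\le l<m\le n$, and $(\varsigma_\theta^j)_{1\le j\le t}$ for $2\le|\theta|\le s+2$, and let $\mathfrak a\subseteq k[\alpha,\beta,v]$ be the ideal generated by its minors of order $t$. Let $MGC_2(A)$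 be the set of points $[H]=(\alpha_1:\dots:\alpha_{h_1}:\beta_1:\dots:\beta_{h_2})\in\mathbb P_k^{h_1+h_2-1}$ such that $R/\operatorname{Ann}_R H$ is a Gorenstein cover of $A$ of colength $2$. Then $$MGC_2(A)=\mathbb V_+(\mathfrak b)\setminus\pi_1\bigl(\mathbb V_+(\mathfrak c)\cap\mathbb V_+(\mathfrak a)\bigr),$$ where $\mathbb V_+(\mathfrak b)\subseteq\mathbb P_k^{h_1+h_2-1}$ and $\mathbb V_+(\mathfrak c),\mathbb V_+(\mathfrak a)\subseteq\mathbb P_k^{h_1+h_2-1}\times\mathbb P_k^{n-1}$ are the sets of zeros, and $\pi_1$ is the projection to the first factor. -/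

import Mathlib

open scoped LinearAlgebra.Projectivization

namespace GorensteinCover

noncomputable section

universe u

variable {k : Type u} [Field k] {n : ℕ}

/-! ### Contraction: `S = k[y₁,…,yₙ]` as a module over `R = k⟦x₁,…,xₙ⟧` -/

/-- The ring of formal power series `R = k⟦x₁,…,xₙ⟧`. -/
abbrev PS (n : ℕ) (k : Type u) [Field k] : Type u := MvPowerSeries (Fin n) k

/-- The polynomial ring `S = k[y₁,…,yₙ]`. -/
abbrev Poly (n : ℕ) (k : Type u) [Field k] : Type u := MvPolynomial (Fin n) k

/-- Contraction by a power series `r = ∑ r_α x^α`: the `k`-linear map `S → S` sending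
`y^γ` to `∑_{α + β = γ} r_α y^β`. -/
def contract (r : PS n k) : Poly n k →ₗ[k] Poly n k :=
  (MvPolynomial.basisMonomials (Fin n) k).constr k fun γ =>
    ∑ p ∈ Finset.HasAntidiagonal.antidiagonal γ, MvPolynomial.monomial p.2 (MvPowerSeries.coeff p.1 r)

theorem contract_monomial (r : PS n k) (γ : Fin n →₀ ℕ) (c : k) :
    contract r (MvPolynomial.monomial γ c) =
      ∑ p ∈ Finset.HasAntidiagonal.antidiagonal γ,
        MvPolynomial.monomial p.2 (c * MvPowerSeries.coeff p.1 r) := by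
  have h1 : (MvPolynomial.monomial γ c : Poly n k) =
      c • (MvPolynomial.basisMonomials (Fin n) k) γ := by
    simp [MvPolynomial.coe_basisMonomials, MvPolynomial.smul_monomial]
  rw [h1, map_smul, contract, Module.Basis.constr_basis, Finset.smul_sum]
  simp [MvPolynomial.smul_monomial]

theorem contract_mul (r s : PS n k) (F : Poly n k) :
    contract (r * s) F = contract r (contract s F) := by
  classical
  induction F using MvPolynomial.induction_on' with
  | add p q hp hq => simp only [map_add, hp, hq]
  | monomial γ c =>
    simp only [contract_monomial, map_sum, MvPowerSeries.coeff_mul, Finset.mul_sum,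
      Finset.sum_sigma']
    apply Finset.sum_nbij' (fun ⟨⟨_i, j⟩, ⟨a, l⟩⟩ ↦ ⟨(l, a + j), (a, j)⟩)
      (fun ⟨⟨i, _j⟩, ⟨a, l⟩⟩ ↦ ⟨(a + i, l), (a, i)⟩)
    · rintro ⟨⟨i, j⟩, ⟨a, l⟩⟩ h
      simp only [Finset.mem_sigma, Finset.HasAntidiagonal.mem_antidiagonal] at h ⊢
      obtain ⟨rfl, rfl⟩ := h
      exact ⟨by abel, trivial⟩
    · rintro ⟨⟨i, j⟩, ⟨a, l⟩⟩ h
      simp only [Finset.mem_sigma, Finset.HasAntidiagonal.mem_antidiagonal] at h ⊢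
      obtain ⟨rfl, rfl⟩ := h
      exact ⟨by abel, trivial⟩
    · rintro ⟨⟨i, j⟩, ⟨a, l⟩⟩ h
      simp only [Finset.mem_sigma, Finset.HasAntidiagonal.mem_antidiagonal] at h ⊢
      obtain ⟨rfl, rfl⟩ := h
      rfl
    · rintro ⟨⟨i, j⟩, ⟨a, l⟩⟩ h
      simp only [Finset.mem_sigma, Finset.HasAntidiagonal.mem_antidiagonal] at h ⊢
      obtain ⟨rfl, rfl⟩ := h
      rfl
    · rintro ⟨⟨i, j⟩, ⟨a, l⟩⟩ h
      simp only
      congr 1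
      ring

theorem contract_one (F : Poly n k) : contract (1 : PS n k) F = F := by
  classical
  induction F using MvPolynomial.induction_on' with
  | add p q hp hq => simp only [map_add, hp, hq]
  | monomial γ c =>
    rw [contract_monomial, Finset.sum_eq_single (0, γ)]
    · simp
    · rintro ⟨a, b⟩ h1 h2
      rw [MvPowerSeries.coeff_one, if_neg, mul_zero, map_zero]
      rintro rfl
      simp only [Finset.HasAntidiagonal.mem_antidiagonal, zero_add] at h1
      exact h2 (by rw [h1])
    · intro h
      exact absurd (by simp) h

theorem contract_add (r s : PS n k) (F : Poly n k) :
    contract (r + s) F = contract r F + contract s F := by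
  induction F using MvPolynomial.induction_on' with
  | add p q hp hq => simp only [map_add, hp, hq]; abel
  | monomial γ c => simp only [contract_monomial, map_add, mul_add, Finset.sum_add_distrib]

theorem contract_smul (c : k) (r : PS n k) (F : Poly n k) :
    contract (c • r) F = c • contract r F := by
  induction F using MvPolynomial.induction_on' with
  | add p q hp hq => simp only [map_add, hp, hq, smul_add]
  | monomial γ d =>
    simp only [contract_monomial, Finset.smul_sum, MvPolynomial.smul_monomial,
      MvPowerSeries.coeff_smul]
    refine Finset.sum_congr rfl fun p _ => ?_
    congr 1
    simp only [smul_eq_mul]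
    ring

/-- `S` is an `R`-module by contraction: `r • F = r ∘ F`. -/
instance instModule : Module (PS n k) (Poly n k) where
  smul r F := contract r F
  one_smul F := contract_one F
  mul_smul r s F := contract_mul r s F
  smul_zero r := map_zero (contract r)
  smul_add r := map_add (contract r)
  add_smul r s F := contract_add r s F
  zero_smul F := by
    have h := contract_smul (0 : k) (0 : PS n k) F
    rw [zero_smul, zero_smul] at h
    exact h

theorem smul_def (r : PS n k) (F : Poly n k) : r • F = contract r F := rfl

instance instIsScalarTower : IsScalarTower k (PS n k) (Poly n k) where
  smul_assoc c r F := contract_smul c r F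

/-- The rule defining contraction on monomials: `x^α ∘ y^β` is `y^(β - α)` if `α ≤ β`, and `0`
otherwise. -/
theorem monomial_smul_monomial (α β : Fin n →₀ ℕ) [Decidable (α ≤ β)] :
    (MvPowerSeries.monomial α (1 : k) : PS n k) • (MvPolynomial.monomial β (1 : k) : Poly n k) =
      if α ≤ β then MvPolynomial.monomial (β - α) 1 else 0 := by
  classical
  rw [smul_def, contract_monomial]
  split_ifs with h
  · rw [Finset.sum_eq_single (α, β - α)]
    · simp
    · rintro ⟨a, b⟩ h1 h2
      rw [MvPowerSeries.coeff_monomial, if_neg, mul_zero, map_zero]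
      rintro rfl
      simp only [Finset.HasAntidiagonal.mem_antidiagonal] at h1
      exact h2 (by rw [← h1]; simp)
    · intro h1
      exact absurd (by simp [add_tsub_cancel_of_le h]) h1
  · refine Finset.sum_eq_zero ?_
    rintro ⟨a, b⟩ h1
    rw [MvPowerSeries.coeff_monomial, if_neg, mul_zero, map_zero]
    rintro rfl
    simp only [Finset.HasAntidiagonal.mem_antidiagonal] at h1
    exact h (h1 ▸ le_self_add)

/-! ### Inverse systems, integrals, Gorenstein covers and Gorenstein colength -/

/-- The Macaulay inverse system `I^⊥ = {G ∈ S | I ∘ G = 0}`. -/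
def invSys (I : Ideal (PS n k)) : Submodule (PS n k) (Poly n k) where
  carrier := {G | ∀ f ∈ I, f • G = 0}
  add_mem' hG hH f hf := by rw [smul_add, hG f hf, hH f hf, add_zero]
  zero_mem' f _ := smul_zero f
  smul_mem' r G hG f hf := by rw [smul_comm, hG f hf, smul_zero]

/-- The integral `∫_K M = {G ∈ S | K ∘ G ⊆ M}` of a submodule `M` of `S` with respect to an
ideal `K` of `R`. -/
def integral (K : Ideal (PS n k)) (M : Submodule (PS n k) (Poly n k)) :
    Submodule (PS n k) (Poly n k) where
  carrier := {G | ∀ f ∈ K, f • G ∈ M}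
  add_mem' hG hH f hf := by rw [smul_add]; exact M.add_mem (hG f hf) (hH f hf)
  zero_mem' f _ := by rw [smul_zero]; exact M.zero_mem
  smul_mem' r G hG f hf := by rw [smul_comm]; exact M.smul_mem r (hG f hf)

/-- The maximal ideal `𝔪` of `R`. -/
abbrev maxIdeal (n : ℕ) (k : Type u) [Field k] : Ideal (PS n k) :=
  IsLocalRing.maximalIdeal (PS n k)

/-- The ideal `Ann_R F` of `R`. -/
abbrev annIdeal (F : Poly n k) : Ideal (PS n k) :=
  (Submodule.span (PS n k) {F}).annihilator

/-- `R / Ann_R F` is a Gorenstein cover of `A = R / I`: `I^⊥ ⊆ ⟨F⟩`. -/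
def IsCover (I : Ideal (PS n k)) (F : Poly n k) : Prop :=
  invSys I ≤ Submodule.span (PS n k) {F}

/-- `R / Ann_R F` is a Gorenstein cover `G` of `A = R / I` with `ℓ(G) - ℓ(A) = d`. -/
def IsCoverOfColength (I : Ideal (PS n k)) (F : Poly n k) (d : ℕ) : Prop :=
  IsCover I F ∧
    Module.length (PS n k) (PS n k ⧸ annIdeal F) = Module.length (PS n k) (PS n k ⧸ I) + d

/-- The Gorenstein colength `gcl(A)` of `A = R / I`: the minimum of `ℓ(G) - ℓ(A)` over all
Gorenstein covers `G = R / Ann_R F` of `A`. -/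
def gcl (I : Ideal (PS n k)) : ℕ :=
  sInf {d : ℕ | ∃ F : Poly n k, IsCoverOfColength I F d}

/-- The socle degree of an Artin local ring `A = R / I`: the largest `j` such that the `j`-th
power of the maximal ideal of `A` is not zero. -/
def socleDegree (I : Ideal (PS n k)) : ℕ :=
  sSup {j : ℕ | ¬ maxIdeal n k ^ j ≤ I}

/-! ### Adapted bases -/

/-- A `k`-basis `b₁,…,b_t,F₁,…,F_{h₁},G₁,…,G_{h₂}` of `∫_{𝔪²} I^⊥` such that `b₁,…,b_t` is a
`k`-basis of `I^⊥` and `b₁,…,b_t,F₁,…,F_{h₁}` is a `k`-basis of `∫_𝔪 I^⊥`. -/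
structure AdaptedBasis (I : Ideal (PS n k)) (t h₁ h₂ : ℕ) where
  /-- The basis of `∫_{𝔪²} I^⊥`, indexed by `{1,…,t} ⊔ ({1,…,h₁} ⊔ {1,…,h₂})`. -/
  basis : Module.Basis (Fin t ⊕ (Fin h₁ ⊕ Fin h₂)) k (integral (maxIdeal n k ^ 2) (invSys I))
  span_b : Submodule.span k (Set.range fun j : Fin t => (basis (Sum.inl j) : Poly n k)) =
    (invSys I).restrictScalars k
  span_bF : Submodule.span k
      (Set.range (Sum.elim (fun j : Fin t => (basis (Sum.inl j) : Poly n k))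
        (fun j : Fin h₁ => (basis (Sum.inr (Sum.inl j)) : Poly n k)))) =
    (integral (maxIdeal n k) (invSys I)).restrictScalars k

namespace AdaptedBasis

variable {I : Ideal (PS n k)} {t h₁ h₂ : ℕ} (D : AdaptedBasis I t h₁ h₂)

/-- The polynomial `H = ∑ α_i F_i + ∑ β_i G_i` with coefficient vector `z = (α, β)`. -/
def poly (z : Fin h₁ ⊕ Fin h₂ → k) : Poly n k :=
  ∑ i, z i • (D.basis (Sum.inr i) : Poly n k)

/-! ### The matrices `B_H`, `C_{H,v}`, `U_{H,v}` and their ideals of minors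

The variables `α_i, β_i` are `X (Sum.inl i)`, `X (Sum.inr i)` in `k[α,β]`. In `k[α,β,v]` the
variables `α, β` carry a further `Sum.inl`, and `v_l` is `X (Sum.inr l)`. -/

/-- The coordinate of `r ∘ H` at the `j`-th element of the adapted basis, as a linear form in the
coefficients `α, β` of `H = ∑ α_i F_i + ∑ β_i G_i`. -/
def coord (r : PS n k) (j : Fin t ⊕ (Fin h₁ ⊕ Fin h₂)) : MvPolynomial (Fin h₁ ⊕ Fin h₂) k :=
  ∑ i, MvPolynomial.C (D.basis.repr (r • D.basis (Sum.inr i)) j) * MvPolynomial.X i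

/-- The matrix `B_H = (ρ_k^j)`, where `x_k ∘ H = ∑ μ_k^j b_j + ∑ ρ_k^j F_j`. -/
def matB : Matrix (Fin n) (Fin h₁) (MvPolynomial (Fin h₁ ⊕ Fin h₂) k) :=
  Matrix.of fun l j => D.coord (MvPowerSeries.X l) (Sum.inr (Sum.inl j))

/-- The matrix `C_{H,v} = (B_H | v)`. -/
def matC : Matrix (Fin n) (Fin h₁ ⊕ Unit) (MvPolynomial ((Fin h₁ ⊕ Fin h₂) ⊕ Fin n) k) :=
  Matrix.fromCols (D.matB.map (MvPolynomial.rename Sum.inl))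
    (Matrix.of fun l _ => MvPolynomial.X (Sum.inr l))

/-- The matrix `U_{H,v}`. Its rows are the `b`-coordinates of `(v_l x_m - v_m x_l) ∘ H` for
`l < m`, and of `x^θ ∘ H` for `2 ≤ |θ| ≤ s + 2`, with `s` the socle degree of `A`. -/
def matU :
    Matrix ({p : Fin n × Fin n // p.1 < p.2} ⊕
        {θ : Fin n →₀ ℕ // 2 ≤ θ.degree ∧ θ.degree ≤ socleDegree I + 2})
      (Fin t) (MvPolynomial ((Fin h₁ ⊕ Fin h₂) ⊕ Fin n) k) :=
  Matrix.fromRows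
    (Matrix.of fun p j =>
      MvPolynomial.X (Sum.inr p.1.1) *
          MvPolynomial.rename Sum.inl (D.coord (MvPowerSeries.X p.1.2) (Sum.inl j)) -
        MvPolynomial.X (Sum.inr p.1.2) *
          MvPolynomial.rename Sum.inl (D.coord (MvPowerSeries.X p.1.1) (Sum.inl j)))
    (Matrix.of fun θ j =>
      MvPolynomial.rename Sum.inl (D.coord (MvPowerSeries.monomial θ.1 1) (Sum.inl j)))

end AdaptedBasis

/-- The ideal generated by all minors of order `d` of a matrix. -/
def minorsIdeal {P ι κ : Type*} [CommRing P] (d : ℕ) (M : Matrix ι κ P) : Ideal P :=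
  Ideal.span {f | ∃ (r : Fin d ↪ ι) (c : Fin d ↪ κ), f = (M.submatrix r c).det}

/-- The set `𝕍₊(J)` of points of a projective space defined by a homogeneous ideal `J`. -/
def projZeros {ι : Type*} (J : Ideal (MvPolynomial ι k)) : Set (ℙ k (ι → k)) :=
  {p | ∀ (z : ι → k) (hz : z ≠ 0), Projectivization.mk k z hz = p →
    ∀ f ∈ J, MvPolynomial.eval z f = 0}

/-- The set `𝕍₊(J)` of points of a product of two projective spaces defined by a bihomogeneous
ideal `J`. -/
def biprojZeros {ι κ : Type*} (J : Ideal (MvPolynomial (ι ⊕ κ) k)) :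
    Set (ℙ k (ι → k) × ℙ k (κ → k)) :=
  {p | ∀ (z : ι → k) (hz : z ≠ 0) (v : κ → k) (hv : v ≠ 0),
    Projectivization.mk k z hz = p.1 → Projectivization.mk k v hv = p.2 →
    ∀ f ∈ J, MvPolynomial.eval (Sum.elim z v) f = 0}

namespace AdaptedBasis

variable {I : Ideal (PS n k)} {t h₁ h₂ : ℕ} (D : AdaptedBasis I t h₁ h₂)

/-- The ideal `𝔟 ⊆ k[α,β]` of minors of order 2 of `B_H`. -/
def idealB : Ideal (MvPolynomial (Fin h₁ ⊕ Fin h₂) k) := minorsIdeal 2 D.matB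

/-- The ideal `𝔠 ⊆ k[α,β,v]` of minors of order 2 of `C_{H,v}`. -/
def idealC : Ideal (MvPolynomial ((Fin h₁ ⊕ Fin h₂) ⊕ Fin n) k) := minorsIdeal 2 D.matC

/-- The ideal `𝔞 ⊆ k[α,β,v]` of minors of order `t` of `U_{H,v}`. -/
def idealA : Ideal (MvPolynomial ((Fin h₁ ⊕ Fin h₂) ⊕ Fin n) k) := minorsIdeal t D.matU

/-- `MGC₂(A)`: the points `[H]`, `H = ∑ α_i F_i + ∑ β_i G_i ≠ 0`, such that `R / Ann_R H` is a
Gorenstein cover of `A` of colength 2. -/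
def MGC2 : Set (ℙ k (Fin h₁ ⊕ Fin h₂ → k)) :=
  {p | ∃ (z : Fin h₁ ⊕ Fin h₂ → k) (hz : z ≠ 0),
    Projectivization.mk k z hz = p ∧ IsCoverOfColength I (D.poly z) 2}

end AdaptedBasis

end

end GorensteinCover

namespace GorensteinCover

universe u

/-! ### Lengths, powers of the maximal ideal, and Macaulay duality -/

section Infrastructure

variable {k : Type u} [Field k] {n : ℕ}

/-! Write J for the integral of I^⊥ over 𝔪². The map `projFG` reading off the F- and G-coordinates
of an element of J has kernel I^⊥. For H with coefficient vector z ≠ 0, it sends ⟨H⟩ onto the span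
of z and the rows of B_H, because 𝔪² carries H into I^⊥. The vector z is independent of those rows:
otherwise a unit of R would carry H into I^⊥. So the image has dimension rank B_H + 1. If I^⊥ ⊆ ⟨H⟩,
rank–nullity gives colength rank B_H + 1; Macaulay duality turns lengths into dimensions. Hence [H]
gives a cover of colength 2 exactly when I^⊥ ⊆ ⟨H⟩ and rank B_H = 1 (`isCoverOfColength_poly_iff`).

The ideal 𝔟 cuts out rank B_H ≤ 1, and 𝔠 says that the columns of B_H are multiples of v. Under that
condition every row of U_{H,v} is the b-coordinate vector of an element of ⟨H⟩ ∩ I^⊥, so full rank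
of U_{H,v} forces I^⊥ ⊆ ⟨H⟩ (`ker_projFG_le_cyc`). If moreover B_H ≠ 0, an element f ∘ H lies in I^⊥
only when f has no constant term and its linear part is orthogonal to v; such elements are
combinations of those giving the rows, so the converse holds (`span_evalU_eq_top`).

When B_H = 0 the converse may fail, but full rank of U_{H,v} would give a cover of colength 1, which
gcl(A) > 1 forbids. So such points are removed by the projection, as they should be. -/

theorem length_field_eq_length (M : Type*) [AddCommGroup M] [Module k M] [Module (PS n k) M]
    [IsScalarTower k (PS n k) M] : Module.length k M = Module.length (PS n k) M := by
  have hloc : IsLocalHom (algebraMap k (PS n k)) := by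
    infer_instance
  -- The residue field of R is k: a series and its constant term have the same residue. This makes
  -- R-length and k-length agree.
  have hsurj : Function.Surjective (algebraMap (IsLocalRing.ResidueField k)
      (IsLocalRing.ResidueField (PS n k))) := by
    intro x
    obtain ⟨f, rfl⟩ := IsLocalRing.residue_surjective x
    refine ⟨IsLocalRing.residue k (MvPowerSeries.constantCoeff f), ?_⟩
    rw [IsLocalRing.ResidueField.algebraMap_residue, ← sub_eq_zero, ← map_sub,
      IsLocalRing.residue_eq_zero_iff, IsLocalRing.mem_maximalIdeal, mem_nonunits_iff,
      MvPowerSeries.isUnit_iff_constantCoeff]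
    simp [MvPowerSeries.algebraMap_apply]
  have h1 : Module.length (IsLocalRing.ResidueField k) (IsLocalRing.ResidueField (PS n k)) = 1 := by
    rw [Module.length_eq_of_surjective (M := IsLocalRing.ResidueField (PS n k)) hsurj,
      Module.length_eq_one]
  rw [IsLocalRing.length_restrictScalars k (PS n k) M, h1, mul_one]

/-- The maximal ideal of an Artinian local ring is its Jacobson radical, hence nilpotent; this is
pulled back to R. -/
theorem exists_maxIdeal_pow_le (I : Ideal (PS n k)) [IsArtinianRing (PS n k ⧸ I)] (hI : I ≠ ⊤) :
    ∃ N, maxIdeal n k ^ N ≤ I := by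
  have : Nontrivial (PS n k ⧸ I) := Ideal.Quotient.nontrivial_iff.mpr hI
  have : IsLocalRing (PS n k ⧸ I) :=
    .of_surjective' (Ideal.Quotient.mk I) Ideal.Quotient.mk_surjective
  obtain ⟨N, hN⟩ := IsArtinianRing.isNilpotent_jacobson_bot (R := PS n k ⧸ I)
  rw [IsLocalRing.jacobson_eq_maximalIdeal _ bot_ne_top] at hN
  refine ⟨N, ?_⟩
  have hmap : (maxIdeal n k).map (Ideal.Quotient.mk I) ≤ IsLocalRing.maximalIdeal (PS n k ⧸ I) := by
    have hl : IsLocalHom (Ideal.Quotient.mk I) := .of_surjective _ Ideal.Quotient.mk_surjective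
    exact ((IsLocalRing.local_hom_TFAE (Ideal.Quotient.mk I)).out 0 2).mp hl
  have h0 : (maxIdeal n k ^ N).map (Ideal.Quotient.mk I) = ⊥ := by
    rw [Ideal.map_pow, eq_bot_iff]
    exact (Ideal.pow_right_mono hmap N).trans hN.le
  rwa [Ideal.map_eq_bot_iff_le_ker, Ideal.mk_ker] at h0

theorem maxIdeal_pow_socleDegree_succ_le (I : Ideal (PS n k)) [IsArtinianRing (PS n k ⧸ I)]
    (hI : I ≠ ⊤) : maxIdeal n k ^ (socleDegree I + 1) ≤ I := by
  obtain ⟨N, hN⟩ := exists_maxIdeal_pow_le I hI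
  by_contra h
  -- A supremum in ℕ bounds a set only if the set is bounded, so `socleDegree` is meaningful only
  -- after this check.
  have hb : BddAbove {j : ℕ | ¬ maxIdeal n k ^ j ≤ I} := by
    refine ⟨N, fun j hj => ?_⟩
    by_contra! hlt
    exact hj ((Ideal.pow_le_pow_right hlt.le).trans hN)
  have := le_csSup hb (show socleDegree I + 1 ∈ {j : ℕ | ¬ maxIdeal n k ^ j ≤ I} from h)
  change socleDegree I + 1 ≤ socleDegree I at this
  omega

theorem X_mem_maxIdeal (l : Fin n) : (MvPowerSeries.X l : PS n k) ∈ maxIdeal n k := by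
  rw [IsLocalRing.mem_maximalIdeal, mem_nonunits_iff, MvPowerSeries.isUnit_iff_constantCoeff]
  simp

theorem monomial_mem_maxIdeal_pow (θ : Fin n →₀ ℕ) (c : k) :
    (MvPowerSeries.monomial θ c : PS n k) ∈ maxIdeal n k ^ θ.degree := by
  induction θ using Finsupp.induction_linear generalizing c with
  | zero => simp
  | add f g hf hg =>
    have h := MvPowerSeries.monomial_mul_monomial f g c (1 : k)
    rw [mul_one] at h
    rw [← h, map_add, pow_add]
    exact Ideal.mul_mem_mul (hf c) (hg 1)
  | single l m =>
    have h := MvPowerSeries.X_pow_eq (R := k) l m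
    have h2 : (MvPowerSeries.monomial (Finsupp.single l m) c : PS n k) =
        c • MvPowerSeries.X l ^ m := by
      rw [h, ← map_smul, smul_eq_mul, mul_one]
    rw [h2, Finsupp.degree_single, Algebra.smul_def]
    exact Ideal.mul_mem_left _ _ (Ideal.pow_mem_pow (X_mem_maxIdeal l) m)

/-- By induction on N: a series without constant term is ∑ x_l g_l, where each g_l has order at
least one less. -/
theorem mem_maxIdeal_pow_of_coeff_eq_zero (N : ℕ) (f : PS n k)
    (hf : ∀ θ : Fin n →₀ ℕ, θ.degree < N → MvPowerSeries.coeff θ f = 0) :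
    f ∈ maxIdeal n k ^ N := by
  classical
  induction N generalizing f with
  | zero => simp
  | succ N ih =>
    -- For each θ ≠ 0 one variable dividing x^θ is chosen, so that each term of f goes into exactly
    -- one g_l.
    let sel : (Fin n →₀ ℕ) → Option (Fin n) := fun θ =>
      if h : ∃ l, θ l ≠ 0 then some h.choose else none
    have hsel : ∀ θ l, sel θ = some l → θ l ≠ 0 := by
      intro θ l h
      by_cases hex : ∃ l, θ l ≠ 0
      · simp only [sel, dif_pos hex, Option.some.injEq] at h
        exact h ▸ hex.choose_spec
      · simp [sel, dif_neg hex] at h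
    have hsel' : ∀ θ, θ ≠ 0 → ∃ l, sel θ = some l := by
      intro θ h
      have hex : ∃ l, θ l ≠ 0 := by
        by_contra! h'
        exact h (Finsupp.ext h')
      exact ⟨hex.choose, by simp only [sel, dif_pos hex]⟩
    let g : Fin n → PS n k := fun l θ =>
      if sel (θ + Finsupp.single l 1) = some l then
        MvPowerSeries.coeff (θ + Finsupp.single l 1) f else 0
    have hg : ∀ l θ, MvPowerSeries.coeff θ (g l) =
      if sel (θ + Finsupp.single l 1) = some l then
        MvPowerSeries.coeff (θ + Finsupp.single l 1) f else 0 := fun l θ => rfl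
    have hsum : f = ∑ l, MvPowerSeries.X l * g l := by
      ext θ
      rw [map_sum]
      have hterm : ∀ l, MvPowerSeries.coeff θ (MvPowerSeries.X l * g l) =
          if sel θ = some l then MvPowerSeries.coeff θ f else 0 := by
        intro l
        rw [MvPowerSeries.X, MvPowerSeries.coeff_monomial_mul]
        by_cases hle : Finsupp.single l 1 ≤ θ
        · rw [if_pos hle, one_mul, hg, tsub_add_cancel_of_le hle]
        · rw [if_neg hle, if_neg]
          intro h
          apply hle
          rw [Finsupp.single_le_iff]
          have := hsel θ l h
          omega
      simp only [hterm]
      by_cases h0 : θ = 0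
      · subst h0
        rw [hf 0 (by simp)]
        simp
      · obtain ⟨l, hl⟩ := hsel' θ h0
        rw [Finset.sum_eq_single l]
        · rw [if_pos hl]
        · intro b _ hb
          rw [if_neg]
          rw [hl]
          simpa using hb.symm
        · simp
    rw [hsum, pow_succ']
    refine Ideal.sum_mem _ fun l _ => Ideal.mul_mem_mul (X_mem_maxIdeal l) (ih _ fun θ hθ => ?_)
    rw [hg]
    split_ifs
    · exact hf _ (by rw [map_add, Finsupp.degree_single]; omega)
    · rfl

/-- Contraction by a power series involves only finitely many of its terms. -/
theorem exists_smul_eq_sum (H : Poly n k) : ∃ S : Finset (Fin n →₀ ℕ), ∀ T, S ⊆ T →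
    ∀ f : PS n k, f • H =
      ∑ θ ∈ T, MvPowerSeries.coeff θ f • ((MvPowerSeries.monomial θ 1 : PS n k) • H) := by
  classical
  induction H using MvPolynomial.induction_on' with
  | add p q hp hq =>
    obtain ⟨S₁, h₁⟩ := hp
    obtain ⟨S₂, h₂⟩ := hq
    refine ⟨S₁ ∪ S₂, fun T hT f => ?_⟩
    rw [smul_add, h₁ T (Finset.union_subset_left hT) f, h₂ T (Finset.union_subset_right hT) f,
      ← Finset.sum_add_distrib]
    simp only [smul_add]
  | monomial γ c =>
    refine ⟨Finset.Iic γ, fun T hT f => ?_⟩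
    have key : ∀ θ, (MvPowerSeries.monomial θ (1 : k) : PS n k) • MvPolynomial.monomial γ c =
        if θ ≤ γ then MvPolynomial.monomial (γ - θ) c else 0 := by
      intro θ
      have h1 : (MvPolynomial.monomial γ c : Poly n k) = c • MvPolynomial.monomial γ 1 := by
        rw [MvPolynomial.smul_monomial, smul_eq_mul, mul_one]
      rw [h1, smul_def, map_smul, ← smul_def, monomial_smul_monomial]
      split_ifs
      · rw [MvPolynomial.smul_monomial, smul_eq_mul, mul_one]
      · rw [smul_zero]
    rw [← Finset.sum_subset hT, smul_def, contract_monomial]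
    · refine Finset.sum_nbij' (fun p => p.1) (fun θ => (θ, γ - θ)) ?_ ?_ ?_ ?_ ?_
      · rintro ⟨a, b⟩ h
        simp only [Finset.HasAntidiagonal.mem_antidiagonal] at h
        simp [← h]
      · intro θ h
        simp only [Finset.mem_Iic] at h
        simp [add_tsub_cancel_of_le h]
      · rintro ⟨a, b⟩ h
        simp only [Finset.HasAntidiagonal.mem_antidiagonal] at h
        simp [← h]
      · intro θ h
        rfl
      · rintro ⟨a, b⟩ h
        simp only [Finset.HasAntidiagonal.mem_antidiagonal] at h
        subst h
        rw [key, if_pos (by simp), MvPolynomial.smul_monomial, smul_eq_mul, add_tsub_cancel_left,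
          mul_comm]
    · intro θ _ h
      rw [key, if_neg (by simpa using h), smul_zero]

/-- The coefficient of y^β in a polynomial is the constant coefficient of its contraction by x^β.
Hence the pairing (f, G) ↦ constant coefficient of f ∘ G determines G. -/
theorem coeff_smul_eq_coeff_zero_smul (f : PS n k) (G : Poly n k) (β : Fin n →₀ ℕ) :
    MvPolynomial.coeff β (f • G) =
      MvPolynomial.coeff 0 (((MvPowerSeries.monomial β 1 : PS n k) * f) • G) := by
  classical
  have key : ∀ (β : Fin n →₀ ℕ) (G : Poly n k), MvPolynomial.coeff 0
      ((MvPowerSeries.monomial β (1 : k) : PS n k) • G) = MvPolynomial.coeff β G := by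
    intro β G
    induction G using MvPolynomial.induction_on' with
    | add p q hp hq => rw [smul_add, MvPolynomial.coeff_add, hp, hq, MvPolynomial.coeff_add]
    | monomial γ c =>
      have h1 : (MvPolynomial.monomial γ c : Poly n k) = c • MvPolynomial.monomial γ 1 := by
        rw [MvPolynomial.smul_monomial, smul_eq_mul, mul_one]
      rw [h1, smul_def, map_smul, ← smul_def, monomial_smul_monomial, MvPolynomial.coeff_smul,
        MvPolynomial.coeff_smul]
      congr 1
      by_cases h : γ = β
      · subst h
        simp
      · rw [MvPolynomial.coeff_monomial, if_neg h]
        split_ifs with h2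
        · rw [MvPolynomial.coeff_monomial, if_neg]
          intro h3
          exact h (le_antisymm (tsub_eq_zero_iff_le.mp h3) h2)
        · simp
  rw [mul_smul, key]

/-- Macaulay duality: `I^⊥` is the `k`-dual of `R / I`. -/
theorem finrank_invSys_eq (I : Ideal (PS n k)) (hI : ∃ N, maxIdeal n k ^ N ≤ I)
    [Module.Finite k (PS n k ⧸ I)] :
    Module.finrank k (invSys I) = Module.finrank k (PS n k ⧸ I) := by
  classical
  obtain ⟨N, hN⟩ := hI
  let W : Submodule k (PS n k) := I.restrictScalars k
  -- The duality pairing; it identifies I^⊥ with the functionals on R that vanish on I.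
  let ev : invSys I →ₗ[k] Module.Dual k (PS n k) := LinearMap.mk₂ k
    (fun G f => MvPolynomial.coeff 0 (f • (G : Poly n k)))
    (fun G G' f => by simp [smul_add])
    (fun c G f => by
      have : f • ((c • G : invSys I) : Poly n k) = c • (f • (G : Poly n k)) := smul_comm f c _
      rw [this, MvPolynomial.coeff_smul])
    (fun G f f' => by simp [add_smul])
    (fun c G f => by simp [smul_assoc])
  have hev : ∀ (G : invSys I) (f : PS n k),
      ev G f = MvPolynomial.coeff 0 (f • (G : Poly n k)) := fun _ _ => rfl
  have hmem : ∀ G, ev G ∈ W.dualAnnihilator := by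
    intro G
    rw [Submodule.mem_dualAnnihilator]
    intro f hf
    rw [hev, G.2 f hf, MvPolynomial.coeff_zero]
  have hbij : Function.Bijective (ev.codRestrict W.dualAnnihilator hmem) := by
    constructor
    · rw [injective_iff_map_eq_zero]
      intro G hG
      have hG' : ev G = 0 := congrArg Subtype.val hG
      ext β
      have := coeff_smul_eq_coeff_zero_smul (1 : PS n k) (G : Poly n k) β
      rw [one_smul, mul_one, ← hev, hG'] at this
      simpa using this
    · rintro ⟨φ, hφ⟩
      rw [Submodule.mem_dualAnnihilator] at hφ
      have hfin : {θ : Fin n →₀ ℕ | θ.degree < N}.Finite :=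
        (Finsupp.finite_of_degree_le (σ := Fin n) N).subset fun θ (h : θ.degree < N) => h.le
      let S := hfin.toFinset
      -- A functional killing I ⊇ 𝔪^N is determined by its values on the monomials of degree below
      -- N; these values are the coefficients of its preimage.
      let G : Poly n k := ∑ θ ∈ S, MvPolynomial.monomial θ (φ (MvPowerSeries.monomial θ 1))
      have hGc : ∀ θ, MvPolynomial.coeff θ G = φ (MvPowerSeries.monomial θ 1) := by
        intro θ
        simp only [G, MvPolynomial.coeff_sum, MvPolynomial.coeff_monomial, Finset.sum_ite_eq']
        split_ifs with h
        · rfl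
        · refine (hφ _ (hN (Ideal.pow_le_pow_right ?_ (monomial_mem_maxIdeal_pow θ 1)))).symm
          simpa [S] using h
      have hpair : ∀ f : PS n k, MvPolynomial.coeff 0 (f • G) = φ f := by
        intro f
        obtain ⟨S', hS'⟩ := exists_smul_eq_sum G
        rw [hS' (S' ∪ S) Finset.subset_union_left f, MvPolynomial.coeff_sum]
        have hterm : ∀ θ, MvPolynomial.coeff 0 (MvPowerSeries.coeff θ f •
            ((MvPowerSeries.monomial θ (1 : k) : PS n k) • G)) =
            φ (MvPowerSeries.monomial θ (MvPowerSeries.coeff θ f)) := by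
          intro θ
          have h := coeff_smul_eq_coeff_zero_smul (1 : PS n k) G θ
          rw [one_smul, mul_one, hGc] at h
          rw [MvPolynomial.coeff_smul, ← h, ← map_smul, ← map_smul, smul_eq_mul, mul_one]
        simp only [hterm]
        rw [← map_sum, ← sub_eq_zero, ← map_sub]
        refine hφ _ (hN (mem_maxIdeal_pow_of_coeff_eq_zero N _ fun θ hθ => ?_))
        have hθS : θ ∈ S' ∪ S := Finset.mem_union_right _ (by simpa [S] using hθ)
        simp [MvPowerSeries.coeff_monomial, hθS]
      have hGI : G ∈ invSys I := by
        intro f hf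
        ext β
        rw [coeff_smul_eq_coeff_zero_smul, hpair, MvPolynomial.coeff_zero]
        exact hφ _ (I.mul_mem_left _ hf)
      refine ⟨⟨G, hGI⟩, ?_⟩
      ext f
      exact hpair f
  rw [(LinearEquiv.ofBijective _ hbij).finrank_eq, ← W.dualQuotEquivDualAnnihilator.finrank_eq,
    Subspace.dual_finrank_eq]
  exact (Submodule.Quotient.restrictScalarsEquiv k I).finrank_eq

/-- An Artinian ring has finite length over itself, and this length equals its length over k. -/
theorem finite_quotient (I : Ideal (PS n k)) [IsArtinianRing (PS n k ⧸ I)] :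
    Module.Finite k (PS n k ⧸ I) := by
  have h : Module.length k (PS n k ⧸ I) ≠ ⊤ := by
    rw [length_field_eq_length (n := n), Module.length_eq_of_surjective (R := PS n k ⧸ I)
      (S := PS n k) (M := PS n k ⧸ I) Ideal.Quotient.mk_surjective]
    exact Module.length_ne_top
  have := (isFiniteLength_iff_isNoetherian_isArtinian.mp (Module.length_ne_top_iff.mp h)).1
  infer_instance

theorem length_quotient_eq_finrank_invSys (I : Ideal (PS n k)) [IsArtinianRing (PS n k ⧸ I)]
    (hI : I ≠ ⊤) : Module.length (PS n k) (PS n k ⧸ I) = Module.finrank k (invSys I) := by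
  have := finite_quotient I
  rw [finrank_invSys_eq I (exists_maxIdeal_pow_le I hI), ← length_field_eq_length,
    Module.length_eq_finrank]

theorem length_quotient_annIdeal (F : Poly n k)
    [Module.Finite k (Submodule.span (PS n k) {F})] :
    Module.length (PS n k) (PS n k ⧸ annIdeal F) =
      Module.finrank k (Submodule.span (PS n k) {F}) := by
  rw [← Module.length_eq_finrank, length_field_eq_length (n := n)]
  have h : annIdeal F = LinearMap.ker (LinearMap.toSpanSingleton (PS n k) (Poly n k) F) := by
    ext r
    rw [annIdeal, Submodule.mem_annihilator_span_singleton, LinearMap.mem_ker,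
      LinearMap.toSpanSingleton_apply]
  rw [h, (LinearMap.quotKerEquivRange _).length_eq, LinearMap.range_toSpanSingleton]

theorem isCoverOfColength_iff (I : Ideal (PS n k)) [IsArtinianRing (PS n k ⧸ I)]
    (hI : I ≠ ⊤) (F : Poly n k) (d : ℕ) [Module.Finite k (Submodule.span (PS n k) {F})] :
    IsCoverOfColength I F d ↔ invSys I ≤ Submodule.span (PS n k) {F} ∧
      Module.finrank k (Submodule.span (PS n k) {F}) = Module.finrank k (invSys I) + d := by
  rw [IsCoverOfColength, IsCover, length_quotient_annIdeal, length_quotient_eq_finrank_invSys I hI]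
  norm_cast

end Infrastructure

/-! ### Vanishing of minors and rank over a field -/

section Minors

variable {k : Type u} [Field k]

theorem forall_minorsIdeal_iff {P ι κ : Type*} [CommRing P] (φ : P →+* k) (d : ℕ)
    (M : Matrix ι κ P) : (∀ f ∈ minorsIdeal d M, φ f = 0) ↔
      ∀ (r : Fin d ↪ ι) (c : Fin d ↪ κ), ((M.map φ).submatrix r c).det = 0 := by
  have hdet : ∀ (r : Fin d ↪ ι) (c : Fin d ↪ κ),
      φ (M.submatrix r c).det = ((M.map φ).submatrix r c).det := fun r c => by
    rw [RingHom.map_det]; rfl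
  constructor
  · intro h r c
    rw [← hdet]
    exact h _ (Ideal.subset_span ⟨r, c, rfl⟩)
  · intro h f hf
    have hle : minorsIdeal d M ≤ RingHom.ker φ := by
      refine Ideal.span_le.mpr ?_
      rintro _ ⟨r, c, rfl⟩
      exact (RingHom.mem_ker).mpr ((hdet r c).trans (h r c))
    exact hle hf

theorem forall_minors_two_iff {ι κ : Type*} (M : Matrix ι κ k) :
    (∀ (r : Fin 2 ↪ ι) (c : Fin 2 ↪ κ), (M.submatrix r c).det = 0) ↔
      ∀ l m i j, M l i * M m j = M l j * M m i := by
  constructor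
  · intro h l m i j
    by_cases hlm : l = m
    · subst hlm; ring
    by_cases hij : i = j
    · subst hij; ring
    have := h ⟨![l, m], by intro a b; fin_cases a <;> fin_cases b <;> simp [hlm, Ne.symm hlm]⟩
      ⟨![i, j], by intro a b; fin_cases a <;> fin_cases b <;> simp [hij, Ne.symm hij]⟩
    rw [Matrix.det_fin_two] at this
    exact sub_eq_zero.mp this
  · intro h r c
    rw [Matrix.det_fin_two]
    simp only [Matrix.submatrix_apply]
    linear_combination h (r 0) (r 1) (c 0) (c 1)

theorem mul_eq_mul_of_rank_le_one {ι κ : Type*} [Fintype κ] (M : Matrix ι κ k)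
    (h : M.rank ≤ 1) (l m : ι) (i j : κ) : M l i * M m j = M l j * M m i := by
  have hr := (M.rank_submatrix_le ![l, m] ![i, j]).trans h
  by_contra hne
  have hu : IsUnit (M.submatrix ![l, m] ![i, j]) := by
    rw [Matrix.isUnit_iff_isUnit_det, Matrix.det_fin_two, isUnit_iff_ne_zero]
    simpa [sub_eq_zero] using hne
  rw [Matrix.rank_of_isUnit _ hu] at hr
  simp at hr

/-- A nonzero maximal minor gives t independent rows; conversely a basis of k^t can be extracted
from spanning rows. -/
theorem exists_minor_ne_zero_iff {ι : Type*} {t : ℕ} (M : Matrix ι (Fin t) k) :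
    (∃ (r : Fin t ↪ ι) (c : Fin t ↪ Fin t), (M.submatrix r c).det ≠ 0) ↔
      Submodule.span k (Set.range M) = ⊤ := by
  constructor
  · rintro ⟨r, c, h⟩
    have hli : LinearIndependent k (M.submatrix r c).row :=
      Matrix.linearIndependent_rows_iff_isUnit.mpr
        ((Matrix.isUnit_iff_isUnit_det _).mpr (isUnit_iff_ne_zero.mpr h))
    let e : Fin t ≃ Fin t := Equiv.ofBijective c (Finite.injective_iff_bijective.mp c.injective)
    have hli' : LinearIndependent k (fun i => M (r i)) :=
      LinearIndependent.of_comp (LinearEquiv.funCongrLeft k k e).toLinearMap hli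
    have := hli'.span_eq_top_of_card_eq_finrank' (by simp)
    rw [eq_top_iff, ← this]
    refine Submodule.span_mono ?_
    rintro _ ⟨i, rfl⟩
    exact ⟨r i, rfl⟩
  · intro h
    obtain ⟨f, hf, -, hli⟩ := Submodule.exists_fun_fin_finrank_span_eq k (Set.range M)
    have hd : Module.finrank k (Submodule.span k (Set.range M)) = t := by
      rw [h, finrank_top, Module.finrank_fin_fun]
    let g : Fin t → (Fin t → k) := f ∘ Fin.cast hd.symm
    have hg : LinearIndependent k g := hli.comp _ (Fin.cast_injective _)
    choose r hr using fun i => hf (Fin.cast hd.symm i)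
    have hinj : Function.Injective r := by
      intro a b hab
      apply hg.injective
      change f _ = f _
      rw [← hr, ← hr, hab]
    refine ⟨⟨r, hinj⟩, Function.Embedding.refl _, ?_⟩
    have hrow : (M.submatrix (⟨r, hinj⟩ : Fin t ↪ ι) (Function.Embedding.refl (Fin t))).row = g := by
      ext i j
      exact congrFun (hr i) j
    rw [← isUnit_iff_ne_zero, ← Matrix.isUnit_iff_isUnit_det,
      ← Matrix.linearIndependent_rows_iff_isUnit, hrow]
    exact hg

end Minors

/-! ### Coordinates in the adapted basis and the colength of ⟨H⟩ -/

section Coordinates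

variable {k : Type u} [Field k] {n : ℕ}

theorem sub_linear_part_mem (f : PS n k) :
    ∀ θ : Fin n →₀ ℕ, θ.degree < 2 → MvPowerSeries.coeff θ (f - MvPowerSeries.coeff 0 f • 1 -
      ∑ l, MvPowerSeries.coeff (Finsupp.single l 1) f • MvPowerSeries.X l) = 0 := by
  classical
  intro θ hθ
  have hcases : θ = 0 ∨ ∃ l, θ = Finsupp.single l 1 := by
    rcases Nat.lt_or_ge θ.degree 1 with h | h
    · left
      exact (Finsupp.degree_eq_zero_iff θ).mp (by omega)
    · right
      have h1 : θ.degree = 1 := by omega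
      have hne : θ ≠ 0 := by
        rintro rfl
        simp at h1
      obtain ⟨l, hl⟩ := Finsupp.ne_iff.mp hne
      have hle : Finsupp.single l 1 ≤ θ := by
        rw [Finsupp.single_le_iff]
        exact Nat.one_le_iff_ne_zero.mpr hl
      refine ⟨l, ?_⟩
      have h2 := congrArg Finsupp.degree (tsub_add_cancel_of_le hle)
      rw [map_add, h1, Finsupp.degree_single] at h2
      have h3 : θ - Finsupp.single l 1 = 0 := (Finsupp.degree_eq_zero_iff _).mp (by omega)
      exact le_antisymm (tsub_eq_zero_iff_le.mp h3) hle
  rcases hcases with rfl | ⟨l, rfl⟩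
  · simp
  · simp only [map_sub, map_sum, MvPowerSeries.coeff_smul, MvPowerSeries.coeff_one,
      MvPowerSeries.coeff_X]
    rw [Finset.sum_eq_single l]
    · simp
    · intro b _ hb
      rw [if_neg, mul_zero]
      intro h
      exact hb (Finsupp.single_left_injective one_ne_zero h).symm
    · simp

namespace AdaptedBasis

variable {I : Ideal (PS n k)} {t h₁ h₂ : ℕ} (D : AdaptedBasis I t h₁ h₂)

/-- The element `H = ∑ α_i F_i + ∑ β_i G_i` of `∫_{𝔪²} I^⊥`. -/
noncomputable def elt (z : Fin h₁ ⊕ Fin h₂ → k) : integral (maxIdeal n k ^ 2) (invSys I) :=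
  ∑ i, z i • D.basis (Sum.inr i)

theorem coe_elt (z : Fin h₁ ⊕ Fin h₂ → k) : (D.elt z : Poly n k) = D.poly z := by
  simp [elt, poly]

theorem elt_smul (c : k) (z : Fin h₁ ⊕ Fin h₂ → k) : D.elt (c • z) = c • D.elt z := by
  simp [elt, Finset.smul_sum, mul_smul]

/-- The coordinates at `F` and `G`. -/
noncomputable def projFG :
    integral (maxIdeal n k ^ 2) (invSys I) →ₗ[k] (Fin h₁ ⊕ Fin h₂ → k) :=
  LinearMap.funLeft k k Sum.inr ∘ₗ D.basis.equivFun.toLinearMap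

/-- The coordinates at `b`. -/
noncomputable def projb : integral (maxIdeal n k ^ 2) (invSys I) →ₗ[k] (Fin t → k) :=
  LinearMap.funLeft k k Sum.inl ∘ₗ D.basis.equivFun.toLinearMap

theorem projFG_apply (x : integral (maxIdeal n k ^ 2) (invSys I)) (i : Fin h₁ ⊕ Fin h₂) :
    D.projFG x i = D.basis.repr x (Sum.inr i) := rfl

theorem projb_apply (x : integral (maxIdeal n k ^ 2) (invSys I)) (j : Fin t) :
    D.projb x j = D.basis.repr x (Sum.inl j) := rfl

theorem eq_of_proj_eq {x y : integral (maxIdeal n k ^ 2) (invSys I)}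
    (h : D.projFG x = D.projFG y) (h' : D.projb x = D.projb y) : x = y := by
  apply D.basis.repr.injective
  ext (j | i)
  · exact congrFun h' j
  · exact congrFun h i

theorem projFG_elt (z : Fin h₁ ⊕ Fin h₂ → k) : D.projFG (D.elt z) = z := by
  classical
  ext i
  rw [projFG_apply, elt]
  simp only [map_sum, map_smul, Module.Basis.repr_self, Finsupp.coe_finsetSum, Finset.sum_apply,
    Finsupp.smul_single, smul_eq_mul, mul_one]
  rw [Finset.sum_eq_single i]
  · simp
  · intro b _ hb
    simp [hb]
  · simp

theorem eval_coord (z : Fin h₁ ⊕ Fin h₂ → k) (r : PS n k) (j : Fin t ⊕ (Fin h₁ ⊕ Fin h₂)) :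
    MvPolynomial.eval z (D.coord r j) = D.basis.repr (r • D.elt z) j := by
  have h : r • D.elt z = ∑ i, z i • (r • D.basis (Sum.inr i)) := by
    rw [elt, Finset.smul_sum]
    exact Finset.sum_congr rfl fun i _ => smul_comm _ _ _
  rw [h, coord]
  simp [mul_comm]

/-- The span conditions on an adapted basis live in S, while the basis lives in the integral;
injectivity of the inclusion transfers them. -/
theorem mem_span_of_coe_mem {ι : Type*} (b : ι → integral (maxIdeal n k ^ 2) (invSys I))
    (x : integral (maxIdeal n k ^ 2) (invSys I))
    (hx : (x : Poly n k) ∈ Submodule.span k (Set.range fun i => (b i : Poly n k))) :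
    x ∈ Submodule.span k (Set.range b) := by
  let J : Submodule k (Poly n k) := (integral (maxIdeal n k ^ 2) (invSys I)).restrictScalars k
  have h : Submodule.map J.subtype (Submodule.span k (Set.range b)) =
      Submodule.span k (Set.range fun i => (b i : Poly n k)) := by
    rw [Submodule.map_span]
    congr 1
    exact (Set.range_comp _ _).symm
  rw [← h] at hx
  obtain ⟨y, hy, hyx⟩ := hx
  rwa [← Subtype.ext (a1 := y) (a2 := x) hyx]

theorem projFG_eq_zero_iff (x : integral (maxIdeal n k ^ 2) (invSys I)) :
    D.projFG x = 0 ↔ (x : Poly n k) ∈ invSys I := by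
  have hb := D.span_b
  constructor
  · intro h
    have hx := D.basis.sum_repr x
    rw [Fintype.sum_sum_type] at hx
    have h0 : ∑ i, D.basis.repr x (Sum.inr i) • D.basis (Sum.inr i) = 0 :=
      Finset.sum_eq_zero fun i _ => by rw [← projFG_apply, h, Pi.zero_apply, zero_smul]
    rw [h0, add_zero] at hx
    change (x : Poly n k) ∈ (invSys I).restrictScalars k
    rw [← hb, ← hx]
    simp only [AddSubmonoidClass.coe_finsetSum]
    exact Submodule.sum_mem _ fun j _ =>
      Submodule.smul_mem _ _ (Submodule.subset_span ⟨j, rfl⟩)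
  · intro h
    change (x : Poly n k) ∈ (invSys I).restrictScalars k at h
    rw [← hb] at h
    have hx := mem_span_of_coe_mem _ x h
    have hle : Submodule.span k (Set.range fun j : Fin t => D.basis (Sum.inl j)) ≤
        LinearMap.ker D.projFG := by
      rw [Submodule.span_le]
      rintro _ ⟨j, rfl⟩
      ext i
      simp [projFG_apply]
    exact hle hx

theorem repr_G_eq_zero (x : integral (maxIdeal n k ^ 2) (invSys I))
    (hx : (x : Poly n k) ∈ integral (maxIdeal n k) (invSys I)) (i : Fin h₂) :
    D.projFG x (Sum.inr i) = 0 := by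
  change (x : Poly n k) ∈ (integral (maxIdeal n k) (invSys I)).restrictScalars k at hx
  rw [← D.span_bF] at hx
  have hx' := mem_span_of_coe_mem (Sum.elim (fun j : Fin t => D.basis (Sum.inl j))
    (fun j : Fin h₁ => D.basis (Sum.inr (Sum.inl j)))) x (by convert hx using 3; ext (_ | _) <;> rfl)
  have hle : Submodule.span k (Set.range (Sum.elim (fun j : Fin t => D.basis (Sum.inl j))
    (fun j : Fin h₁ => D.basis (Sum.inr (Sum.inl j))))) ≤
        LinearMap.ker (LinearMap.proj (Sum.inr i) ∘ₗ D.projFG) := by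
    rw [Submodule.span_le]
    rintro _ ⟨j | j, rfl⟩
    · simp [projFG_apply]
    · simp [projFG_apply]
  exact hle hx'

theorem projFG_smul_eq_zero {f : PS n k} (hf : f ∈ maxIdeal n k ^ 2)
    (x : integral (maxIdeal n k ^ 2) (invSys I)) : D.projFG (f • x) = 0 :=
  (D.projFG_eq_zero_iff _).mpr (x.2 f hf)

/-- The matrix `B_H` at a point. -/
noncomputable def evalB (z : Fin h₁ ⊕ Fin h₂ → k) : Matrix (Fin n) (Fin h₁) k :=
  fun l j => D.projFG ((MvPowerSeries.X l : PS n k) • D.elt z) (Sum.inl j)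

theorem projFG_X_smul (z : Fin h₁ ⊕ Fin h₂ → k) (l : Fin n) :
    D.projFG ((MvPowerSeries.X l : PS n k) • D.elt z) = Sum.elim (D.evalB z l) 0 := by
  ext (j | j)
  · rfl
  -- Since 𝔪 · x_l ⊆ 𝔪², x_l ∘ H lies in the integral of I^⊥ over 𝔪 and has no G-coordinates.
  · refine D.repr_G_eq_zero _ (fun f hf => ?_) j
    change f • (MvPowerSeries.X l : PS n k) • (D.elt z : Poly n k) ∈ _
    rw [← mul_smul]
    refine (D.elt z).2 _ ?_
    rw [pow_two]
    exact Ideal.mul_mem_mul hf (X_mem_maxIdeal l)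

theorem matB_map_eval (z : Fin h₁ ⊕ Fin h₂ → k) : D.matB.map (MvPolynomial.eval z) = D.evalB z := by
  ext l j
  simp only [matB, Matrix.map_apply, Matrix.of_apply, eval_coord]
  rfl

/-- The `k`-subspace `⟨H⟩` of `∫_{𝔪²} I^⊥`. -/
noncomputable def cyc (z : Fin h₁ ⊕ Fin h₂ → k) :
    Submodule k (integral (maxIdeal n k ^ 2) (invSys I)) :=
  (Submodule.span (PS n k) {D.elt z}).restrictScalars k

theorem mem_cyc {z : Fin h₁ ⊕ Fin h₂ → k} {x : integral (maxIdeal n k ^ 2) (invSys I)} :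
    x ∈ D.cyc z ↔ ∃ f : PS n k, f • D.elt z = x := by
  rw [cyc, Submodule.restrictScalars_mem, Submodule.mem_span_singleton]

/-- Splits f into constant term, linear part and remainder g. Membership of g in 𝔪² kills its F- and
G-coordinates on H; the vanishing of its low coefficients lets g ∘ H be expanded in the x^θ ∘ H with
|θ| ≥ 2. -/
theorem smul_elt_eq (z : Fin h₁ ⊕ Fin h₂ → k) (f : PS n k) : ∃ g : PS n k,
    (∀ θ : Fin n →₀ ℕ, θ.degree < 2 → MvPowerSeries.coeff θ g = 0) ∧ g ∈ maxIdeal n k ^ 2 ∧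
    f • D.elt z = MvPowerSeries.coeff 0 f • D.elt z +
      ∑ l, MvPowerSeries.coeff (Finsupp.single l 1) f • ((MvPowerSeries.X l : PS n k) • D.elt z) +
        g • D.elt z := by
  refine ⟨_, sub_linear_part_mem f,
    mem_maxIdeal_pow_of_coeff_eq_zero 2 _ (sub_linear_part_mem f), ?_⟩
  have hf : f = MvPowerSeries.coeff 0 f • 1 +
      ∑ l, MvPowerSeries.coeff (Finsupp.single l 1) f • MvPowerSeries.X l +
      (f - MvPowerSeries.coeff 0 f • 1 -
        ∑ l, MvPowerSeries.coeff (Finsupp.single l 1) f • MvPowerSeries.X l) := by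
    abel
  conv_lhs => rw [hf]
  simp only [add_smul, Finset.sum_smul, smul_assoc, one_smul]

/-- If z were ∑ a_l times the coordinates of x_l ∘ H, the unit 1 − ∑ a_l x_l would carry H into I^⊥.
Then H itself would lie in I^⊥, so z = 0. -/
theorem notMem_span_evalB {z : Fin h₁ ⊕ Fin h₂ → k} (hz : z ≠ 0) :
    z ∉ Submodule.span k (Set.range fun l =>
      D.projFG ((MvPowerSeries.X l : PS n k) • D.elt z)) := by
  intro h
  obtain ⟨a, ha⟩ := (Submodule.mem_span_range_iff_exists_fun k).mp h
  let u : PS n k := 1 + ∑ l, (-a l) • MvPowerSeries.X l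
  have hu : IsUnit u := by
    rw [MvPowerSeries.isUnit_iff_constantCoeff]
    simp [u]
  have h0 : D.projFG (u • D.elt z) = 0 := by
    simp only [u, add_smul, one_smul, Finset.sum_smul, smul_assoc, map_add, map_sum, map_smul,
      projFG_elt]
    simp only [neg_smul, Finset.sum_neg_distrib, ha, add_neg_cancel]
  rw [projFG_eq_zero_iff] at h0
  obtain ⟨w, hw⟩ := hu
  have h1 : (D.elt z : Poly n k) ∈ invSys I := by
    have := (invSys I).smul_mem (↑w⁻¹ : PS n k) h0
    change (↑w⁻¹ : PS n k) • u • (D.elt z : Poly n k) ∈ _ at this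
    rwa [← mul_smul, ← hw, Units.inv_mul, one_smul] at this
  rw [← projFG_eq_zero_iff, projFG_elt] at h1
  exact hz h1

theorem map_projFG_cyc (z : Fin h₁ ⊕ Fin h₂ → k) :
    (D.cyc z).map D.projFG = Submodule.span k {z} ⊔ Submodule.span k (Set.range fun l =>
      D.projFG ((MvPowerSeries.X l : PS n k) • D.elt z)) := by
  apply le_antisymm
  · rintro _ ⟨x, hx, rfl⟩
    obtain ⟨f, rfl⟩ := D.mem_cyc.mp hx
    obtain ⟨g, -, hg, hfg⟩ := D.smul_elt_eq z f
    rw [hfg, map_add, map_add, D.projFG_smul_eq_zero hg, add_zero, map_smul, map_sum, projFG_elt]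
    refine Submodule.add_mem_sup
      (Submodule.smul_mem _ _ (Submodule.mem_span_singleton_self z))
      (Submodule.sum_mem _ fun l _ => ?_)
    rw [map_smul]
    exact Submodule.smul_mem _ _ (Submodule.subset_span ⟨l, rfl⟩)
  · refine sup_le ?_ ?_
    · rw [Submodule.span_singleton_le_iff_mem]
      exact ⟨D.elt z, D.mem_cyc.mpr ⟨1, one_smul _ _⟩, D.projFG_elt z⟩
    · rw [Submodule.span_le]
      rintro _ ⟨l, rfl⟩
      exact ⟨_, D.mem_cyc.mpr ⟨_, rfl⟩, rfl⟩

/-- The image is the direct sum of the line through z and the row space of B_H, padded by zero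
G-coordinates. -/
theorem finrank_map_projFG_cyc {z : Fin h₁ ⊕ Fin h₂ → k} (hz : z ≠ 0) :
    Module.finrank k ((D.cyc z).map D.projFG) = (D.evalB z).rank + 1 := by
  let ι : (Fin h₁ → k) →ₗ[k] (Fin h₁ ⊕ Fin h₂ → k) :=
    { toFun := fun w => Sum.elim w 0
      map_add' := fun w w' => by ext (i | i) <;> simp
      map_smul' := fun c w => by ext (i | i) <;> simp }
  have hι : Function.Injective ι := fun w w' h => by
    ext i
    exact congrFun h (Sum.inl i)
  have hspan : Submodule.span k (Set.range fun l =>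
      D.projFG ((MvPowerSeries.X l : PS n k) • D.elt z)) =
      (Submodule.span k (Set.range (D.evalB z).row)).map ι := by
    rw [Submodule.map_span, ← Set.range_comp]
    congr 2
    funext l
    exact D.projFG_X_smul z l
  have hdisj : Submodule.span k {z} ⊓ Submodule.span k (Set.range fun l =>
      D.projFG ((MvPowerSeries.X l : PS n k) • D.elt z)) = ⊥ := by
    rw [← disjoint_iff, disjoint_comm, Submodule.disjoint_span_singleton' hz]
    exact D.notMem_span_evalB hz
  have h := Submodule.finrank_sup_add_finrank_inf_eq (Submodule.span k {z})
    (Submodule.span k (Set.range fun l => D.projFG ((MvPowerSeries.X l : PS n k) • D.elt z)))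
  rw [hdisj, finrank_bot, add_zero, ← map_projFG_cyc, finrank_span_singleton hz, hspan,
    ← (Submodule.equivMapOfInjective ι hι _).finrank_eq, ← Matrix.rank_eq_finrank_span_row] at h
  rw [h, add_comm]

/-- Once I^⊥ ⊆ ⟨H⟩, the colength is the dimension of ⟨H⟩ / I^⊥, which is the image of ⟨H⟩ in the F-
and G-coordinates. -/
theorem isCoverOfColength_poly_iff [IsArtinianRing (PS n k ⧸ I)] (hI : I ≠ ⊤)
    {z : Fin h₁ ⊕ Fin h₂ → k} (hz : z ≠ 0) (d : ℕ) :
    IsCoverOfColength I (D.poly z) d ↔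
      LinearMap.ker D.projFG ≤ D.cyc z ∧ (D.evalB z).rank + 1 = d := by
  let J : Submodule k (Poly n k) := (integral (maxIdeal n k ^ 2) (invSys I)).restrictScalars k
  have hfJ : Module.Finite k (integral (maxIdeal n k ^ 2) (invSys I)) := .of_basis D.basis
  let j : integral (maxIdeal n k ^ 2) (invSys I) →ₗ[k] Poly n k := J.subtype
  have hj : Function.Injective j := Subtype.val_injective
  have hcyc : (D.cyc z).map j = (Submodule.span (PS n k) {D.poly z}).restrictScalars k := by
    ext G
    rw [Submodule.restrictScalars_mem, Submodule.mem_span_singleton]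
    constructor
    · rintro ⟨x, hx, rfl⟩
      obtain ⟨f, rfl⟩ := D.mem_cyc.mp hx
      exact ⟨f, by rw [← coe_elt]; rfl⟩
    · rintro ⟨f, rfl⟩
      exact ⟨f • D.elt z, D.mem_cyc.mpr ⟨f, rfl⟩, by rw [← coe_elt]; rfl⟩
  have hker : (LinearMap.ker D.projFG).map j = (invSys I).restrictScalars k := by
    ext G
    rw [Submodule.restrictScalars_mem]
    constructor
    · rintro ⟨x, hx, rfl⟩
      exact (D.projFG_eq_zero_iff x).mp hx
    · intro hG
      have hGJ : G ∈ integral (maxIdeal n k ^ 2) (invSys I) :=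
        fun f _ => (invSys I).smul_mem f hG
      exact ⟨⟨G, hGJ⟩, (D.projFG_eq_zero_iff _).mpr hG, rfl⟩
  have ecyc := (Submodule.equivMapOfInjective j hj (D.cyc z)).trans (LinearEquiv.ofEq _ _ hcyc)
  have eker := (Submodule.equivMapOfInjective j hj (LinearMap.ker D.projFG)).trans
    (LinearEquiv.ofEq _ _ hker)
  have hfin : Module.Finite k (Submodule.span (PS n k) {D.poly z}) := Module.Finite.equiv ecyc
  have hle : invSys I ≤ Submodule.span (PS n k) {D.poly z} ↔
      LinearMap.ker D.projFG ≤ D.cyc z := by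
    rw [← Submodule.map_le_map_iff_of_injective hj, hker, hcyc]
    rfl
  have e1 : Module.finrank k (Submodule.span (PS n k) {D.poly z}) = Module.finrank k (D.cyc z) :=
    ecyc.finrank_eq.symm
  have e2 : Module.finrank k (invSys I) = Module.finrank k (LinearMap.ker D.projFG) :=
    eker.finrank_eq.symm
  rw [isCoverOfColength_iff I hI, hle, e1, e2]
  refine and_congr_right fun hkc => ?_
  let _ := Module.addCommMonoidToAddCommGroup k (M := D.cyc z)
  have hrn := LinearMap.finrank_range_add_finrank_ker (D.projFG ∘ₗ (D.cyc z).subtype)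
  rw [LinearMap.range_comp, Submodule.range_subtype, D.finrank_map_projFG_cyc hz,
    LinearMap.ker_comp, (Submodule.comapSubtypeEquivOfLe hkc).finrank_eq] at hrn
  omega

end AdaptedBasis

end Coordinates

/-! ### The conditions 𝔟, 𝔠, 𝔞 at a point, and the rank of U -/

section MainTheorem

variable {k : Type u} [Field k] {n : ℕ}

theorem smul_mem_span_monomial_smul {J : Submodule (PS n k) (Poly n k)} (f : PS n k) (x : J) :
    f • x ∈ Submodule.span k {y : J | ∃ θ, MvPowerSeries.coeff θ f ≠ 0 ∧
      y = (MvPowerSeries.monomial θ (1 : k) : PS n k) • x} := by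
  obtain ⟨S, hS⟩ := exists_smul_eq_sum (x : Poly n k)
  have h : f • x = ∑ θ ∈ S,
      MvPowerSeries.coeff θ f • ((MvPowerSeries.monomial θ (1 : k) : PS n k) • x) := by
    apply Subtype.ext
    rw [AddSubmonoidClass.coe_finsetSum]
    exact hS S subset_rfl f
  rw [h]
  refine Submodule.sum_mem _ fun θ _ => ?_
  by_cases h : MvPowerSeries.coeff θ f = 0
  · rw [h, zero_smul]
    exact Submodule.zero_mem _
  · exact Submodule.smul_mem _ _ (Submodule.subset_span ⟨θ, h, rfl⟩)

namespace AdaptedBasis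

variable {I : Ideal (PS n k)} {t h₁ h₂ : ℕ} (D : AdaptedBasis I t h₁ h₂)

theorem evalB_smul (c : k) (z : Fin h₁ ⊕ Fin h₂ → k) : D.evalB (c • z) = c • D.evalB z := by
  ext l j
  have h : (MvPowerSeries.X l : PS n k) • D.elt (c • z) =
      c • ((MvPowerSeries.X l : PS n k) • D.elt z) := by
    rw [elt_smul]
    exact smul_comm _ _ _
  simp only [evalB, h, map_smul]
  rfl

/-- Every column of `B_H` is proportional to `v`. -/
def ColProp (z : Fin h₁ ⊕ Fin h₂ → k) (v : Fin n → k) : Prop :=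
  ∀ l m j, D.evalB z l j * v m = D.evalB z m j * v l

theorem eval_idealB_iff (z : Fin h₁ ⊕ Fin h₂ → k) :
    (∀ f ∈ D.idealB, MvPolynomial.eval z f = 0) ↔
      ∀ l m i j, D.evalB z l i * D.evalB z m j = D.evalB z l j * D.evalB z m i := by
  rw [idealB, forall_minorsIdeal_iff (MvPolynomial.eval z), forall_minors_two_iff, matB_map_eval]

/-- Dividing a row m with v_m ≠ 0 by v_m yields w with B_H = v wᵀ. This bounds the rank by 1 and
makes linear relations between rows of B_H readable from v. -/
theorem ColProp.evalB_eq {D : AdaptedBasis I t h₁ h₂} {z : Fin h₁ ⊕ Fin h₂ → k} {v : Fin n → k}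
    (h : D.ColProp z v) (hv : v ≠ 0) : ∃ w, D.evalB z = Matrix.vecMulVec v w := by
  obtain ⟨m, hm⟩ := Function.ne_iff.mp hv
  refine ⟨fun j => D.evalB z m j / v m, ?_⟩
  ext l j
  rw [Matrix.vecMulVec_apply, mul_div_assoc', eq_div_iff hm, h l m j, mul_comm]

/-- Only the minors that use the column v need to be imposed: as v ≠ 0, they give B_H = v wᵀ, and
the minors inside B_H then vanish too. -/
theorem eval_idealC_iff (z : Fin h₁ ⊕ Fin h₂ → k) {v : Fin n → k} (hv : v ≠ 0) :
    (∀ f ∈ D.idealC, MvPolynomial.eval (Sum.elim z v) f = 0) ↔ D.ColProp z v := by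
  have hl : ∀ l j, (D.matC.map (MvPolynomial.eval (Sum.elim z v))) l (Sum.inl j) =
      D.evalB z l j := by
    intro l j
    rw [← matB_map_eval]
    simp [matC, MvPolynomial.eval_rename]
  have hr : ∀ l j, (D.matC.map (MvPolynomial.eval (Sum.elim z v))) l (Sum.inr j) = v l := by
    intro l j
    simp [matC]
  rw [idealC, forall_minorsIdeal_iff (MvPolynomial.eval (Sum.elim z v)), forall_minors_two_iff]
  constructor
  · intro h l m j
    have := h l m (Sum.inl j) (Sum.inr ())
    rw [hl, hr, hl, hr] at this
    rw [this, mul_comm]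
  · intro h
    obtain ⟨w, hw⟩ := h.evalB_eq hv
    rintro l m (i | i) (j | j) <;> simp only [hl, hr, hw, Matrix.vecMulVec_apply] <;> ring

/-- The matrix `U_{H,v}` at a point. -/
noncomputable def evalU (z : Fin h₁ ⊕ Fin h₂ → k) (v : Fin n → k) :
    Matrix ({p : Fin n × Fin n // p.1 < p.2} ⊕
      {θ : Fin n →₀ ℕ // 2 ≤ θ.degree ∧ θ.degree ≤ socleDegree I + 2}) (Fin t) k :=
  Sum.elim
    (fun p => v p.1.1 • D.projb ((MvPowerSeries.X p.1.2 : PS n k) • D.elt z) -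
      v p.1.2 • D.projb ((MvPowerSeries.X p.1.1 : PS n k) • D.elt z))
    (fun θ => D.projb ((MvPowerSeries.monomial θ.1 1 : PS n k) • D.elt z))

theorem matU_map_eval (z : Fin h₁ ⊕ Fin h₂ → k) (v : Fin n → k) :
    D.matU.map (MvPolynomial.eval (Sum.elim z v)) = D.evalU z v := by
  ext (p | θ) j
  · simp [matU, evalU, MvPolynomial.eval_rename, eval_coord, projb_apply]
  · simp [matU, evalU, MvPolynomial.eval_rename, eval_coord, projb_apply]

theorem exists_eval_idealA_ne_zero_iff (z : Fin h₁ ⊕ Fin h₂ → k) (v : Fin n → k) :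
    (∃ f ∈ D.idealA, MvPolynomial.eval (Sum.elim z v) f ≠ 0) ↔
      Submodule.span k (Set.range (D.evalU z v)) = ⊤ := by
  rw [← exists_minor_ne_zero_iff, ← matU_map_eval, ← not_iff_not]
  push Not
  exact forall_minorsIdeal_iff (MvPolynomial.eval (Sum.elim z v)) t D.matU

/-- Rows of U are b-coordinates of elements of ⟨H⟩ ∩ I^⊥, and an element of I^⊥ is determined by its
b-coordinates. The argument allows B_H = 0, which is needed to rule that case out by the Gorenstein
colength. -/
theorem ker_projFG_le_cyc {z : Fin h₁ ⊕ Fin h₂ → k} {v : Fin n → k} (h : D.ColProp z v)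
    (hU : Submodule.span k (Set.range (D.evalU z v)) = ⊤) :
    LinearMap.ker D.projFG ≤ D.cyc z := by
  have hle : Submodule.span k (Set.range (D.evalU z v)) ≤
      (D.cyc z ⊓ LinearMap.ker D.projFG).map D.projb := by
    rw [Submodule.span_le]
    rintro _ ⟨p | θ, rfl⟩
    · refine ⟨(v p.1.1 • MvPowerSeries.X p.1.2 + (-v p.1.2) • MvPowerSeries.X p.1.1 : PS n k) •
        D.elt z, ⟨D.mem_cyc.mpr ⟨_, rfl⟩, ?_⟩, ?_⟩
      · change D.projFG _ = 0
        simp only [add_smul, smul_assoc, map_add, map_smul, projFG_X_smul]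
        ext (j | j)
        · simp only [Pi.add_apply, Pi.smul_apply, Sum.elim_inl, smul_eq_mul, Pi.zero_apply]
          -- Proportionality of the columns to v cancels the F-coordinates of (v_l x_m − v_m x_l) ∘
          -- H.
          linear_combination h p.1.2 p.1.1 j
        · simp
      · rw [add_smul, smul_assoc, smul_assoc, map_add, map_smul D.projb (v p.1.1),
          map_smul D.projb (-v p.1.2), neg_smul, ← sub_eq_add_neg]
        rfl
    · refine ⟨(MvPowerSeries.monomial θ.1 1 : PS n k) • D.elt z, ⟨D.mem_cyc.mpr ⟨_, rfl⟩, ?_⟩, rfl⟩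
      exact D.projFG_smul_eq_zero
        (Ideal.pow_le_pow_right θ.2.1 (monomial_mem_maxIdeal_pow θ.1 1)) _
  intro x hx
  have hx' : D.projb x ∈ Submodule.span k (Set.range (D.evalU z v)) := hU ▸ Submodule.mem_top
  obtain ⟨y, ⟨hy1, hy2⟩, hyx⟩ := hle hx'
  have hxy : y = x := D.eq_of_proj_eq (by
    rw [LinearMap.mem_ker.mp hx]; exact hy2) hyx
  exact hxy ▸ hy1

/-- Here x^θ ∈ 𝔪^(s+3) = 𝔪^(s+1) 𝔪² ⊆ I 𝔪², and I 𝔪² annihilates the integral over 𝔪². This is why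
the rows of U stop at degree s + 2. -/
theorem monomial_smul_elt_eq_zero [IsArtinianRing (PS n k ⧸ I)] (hI : I ≠ ⊤)
    (x : integral (maxIdeal n k ^ 2) (invSys I)) {θ : Fin n →₀ ℕ}
    (hθ : socleDegree I + 2 < θ.degree) : (MvPowerSeries.monomial θ (1 : k) : PS n k) • x = 0 := by
  have hmem : (MvPowerSeries.monomial θ (1 : k) : PS n k) ∈ I * maxIdeal n k ^ 2 := by
    have h1 : (MvPowerSeries.monomial θ (1 : k) : PS n k) ∈
        maxIdeal n k ^ (socleDegree I + 1 + 2) :=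
      Ideal.pow_le_pow_right (by omega) (monomial_mem_maxIdeal_pow θ 1)
    rw [pow_add] at h1
    exact Ideal.mul_mono_left (maxIdeal_pow_socleDegree_succ_le I hI) h1
  have hann : ∀ f ∈ I * maxIdeal n k ^ 2, f • x = 0 := by
    intro f hf
    induction hf using Submodule.mul_induction_on' with
    | mem_mul_mem a ha b hb =>
      apply Subtype.ext
      change (a * b) • (x : Poly n k) = 0
      rw [mul_smul]
      exact x.2 b hb a ha
    | add a _ b _ ha hb => rw [add_smul, ha, hb, add_zero]
  exact hann _ hmem

/-- Each element of I^⊥ is some f ∘ H; its vanishing F- and G-coordinates restrict the constant and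
linear parts of f enough to write its b-coordinates through the rows of U. The hypothesis B_H ≠ 0 is
what forces the linear part to be orthogonal to v. -/
theorem span_evalU_eq_top [IsArtinianRing (PS n k ⧸ I)] (hI : I ≠ ⊤)
    {z : Fin h₁ ⊕ Fin h₂ → k} (hz : z ≠ 0) {v : Fin n → k} (hv : v ≠ 0) (h : D.ColProp z v)
    (hB : D.evalB z ≠ 0) (hker : LinearMap.ker D.projFG ≤ D.cyc z) :
    Submodule.span k (Set.range (D.evalU z v)) = ⊤ := by
  obtain ⟨w, hw⟩ := h.evalB_eq hv
  obtain ⟨j₀, hj₀⟩ : ∃ j, w j ≠ 0 := by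
    by_contra! hw0
    apply hB
    ext l j
    rw [hw, Matrix.vecMulVec_apply, hw0, mul_zero, Matrix.zero_apply]
  obtain ⟨m, hm⟩ := Function.ne_iff.mp hv
  rw [Pi.zero_apply] at hm
  set W := Submodule.span k (Set.range (D.evalU z v)) with hW
  -- U has a row only for each ordered pair l < m; the reversed pairs differ by sign and the
  -- diagonal ones vanish.
  have hpair : ∀ l, v m • D.projb ((MvPowerSeries.X l : PS n k) • D.elt z) -
      v l • D.projb ((MvPowerSeries.X m : PS n k) • D.elt z) ∈ W := by
    intro l
    rcases lt_trichotomy m l with hlt | rfl | hlt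
    · exact Submodule.subset_span ⟨Sum.inl ⟨(m, l), hlt⟩, rfl⟩
    · rw [sub_self]
      exact W.zero_mem
    · rw [← neg_sub]
      exact W.neg_mem (Submodule.subset_span ⟨Sum.inl ⟨(l, m), hlt⟩, rfl⟩)
  have hhigh : ∀ g : PS n k, (∀ θ : Fin n →₀ ℕ, θ.degree < 2 → MvPowerSeries.coeff θ g = 0) →
      D.projb (g • D.elt z) ∈ W := by
    intro g hg
    have hle : Submodule.span k {y | ∃ θ, MvPowerSeries.coeff θ g ≠ 0 ∧
        y = (MvPowerSeries.monomial θ (1 : k) : PS n k) • D.elt z} ≤ W.comap D.projb := by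
      rw [Submodule.span_le]
      rintro _ ⟨θ, hθ, rfl⟩
      change D.projb _ ∈ W
      have h2 : 2 ≤ θ.degree := by
        by_contra! hlt
        exact hθ (hg θ hlt)
      by_cases hs : θ.degree ≤ socleDegree I + 2
      · exact Submodule.subset_span ⟨Sum.inr ⟨θ, h2, hs⟩, rfl⟩
      · rw [monomial_smul_elt_eq_zero hI _ (not_le.mp hs), map_zero]
        exact W.zero_mem
    exact hle (smul_mem_span_monomial_smul g (D.elt z))
  rw [eq_top_iff]
  intro y _
  let x := ∑ j, y j • D.basis (Sum.inl j)
  have hxb : D.projb x = y := by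
    ext j
    rw [projb_apply]
    simp only [x, map_sum, map_smul, Module.Basis.repr_self, Finsupp.coe_finsetSum,
      Finset.sum_apply, Finsupp.smul_single, smul_eq_mul, mul_one]
    rw [Finset.sum_eq_single j]
    · simp
    · intro b _ hb
      simp [hb]
    · simp
  have hxF : D.projFG x = 0 := by
    ext i
    rw [projFG_apply]
    simp [x]
  obtain ⟨f, hf⟩ := D.mem_cyc.mp (hker hxF)
  obtain ⟨g, hg, hg2, hfg⟩ := D.smul_elt_eq z f
  rw [hf] at hfg
  set c := MvPowerSeries.coeff 0 f
  set a : Fin n → k := fun l => MvPowerSeries.coeff (Finsupp.single l 1) f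
  have hF : c • z + ∑ l, a l • D.projFG ((MvPowerSeries.X l : PS n k) • D.elt z) = 0 := by
    rw [← hxF, hfg, map_add, map_add, D.projFG_smul_eq_zero hg2, add_zero, map_smul, map_sum,
      projFG_elt]
    simp only [map_smul, a]
  have hc : c = 0 := by
    by_contra hc
    apply D.notMem_span_evalB hz
    have hmem : c • z ∈ Submodule.span k (Set.range fun l =>
        D.projFG ((MvPowerSeries.X l : PS n k) • D.elt z)) := by
      rw [eq_neg_of_add_eq_zero_left hF]
      exact Submodule.neg_mem _ (Submodule.sum_mem _ fun l _ =>
        Submodule.smul_mem _ _ (Submodule.subset_span ⟨l, rfl⟩))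
    exact (Submodule.smul_mem_iff _ hc).mp hmem
  -- With c = 0 and B_H = v wᵀ, the j₀-th F-coordinate of the relation reads (∑ a_l v_l) w_{j₀} = 0.
  have hav : ∑ l, a l * v l = 0 := by
    have := congrFun hF (Sum.inl j₀)
    rw [hc, zero_smul, zero_add] at this
    simp only [projFG_X_smul, Finset.sum_apply, Pi.smul_apply, Sum.elim_inl, hw,
      Matrix.vecMulVec_apply, smul_eq_mul, Pi.zero_apply, ← mul_assoc, ← Finset.sum_mul] at this
    exact (mul_eq_zero.mp this).resolve_right hj₀
  have hy : y = ∑ l, a l • D.projb ((MvPowerSeries.X l : PS n k) • D.elt z) +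
      D.projb (g • D.elt z) := by
    rw [← hxb, hfg, map_add, map_add, map_smul, hc, zero_smul, zero_add, map_sum]
    simp only [map_smul, a]
  rw [hy]
  refine W.add_mem ?_ (hhigh g hg)
  rw [← W.smul_mem_iff hm, Finset.smul_sum]
  -- The subtracted terms add up to (∑ a_l v_l) times a fixed vector, which is zero; after scaling
  -- by v_m ≠ 0 the linear part is a combination of rows of U.
  have hsum : ∑ l, v m • a l • D.projb ((MvPowerSeries.X l : PS n k) • D.elt z) =
      ∑ l, a l • (v m • D.projb ((MvPowerSeries.X l : PS n k) • D.elt z) -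
        v l • D.projb ((MvPowerSeries.X m : PS n k) • D.elt z)) := by
    simp only [smul_sub, Finset.sum_sub_distrib, smul_smul, ← Finset.sum_smul, hav, zero_smul,
      sub_zero, mul_comm (v m)]
  rw [hsum]
  exact W.sum_mem fun l _ => W.smul_mem _ (hpair l)

theorem mk_mem_projZeros_idealB_iff {z : Fin h₁ ⊕ Fin h₂ → k} (hz : z ≠ 0) :
    Projectivization.mk k z hz ∈ projZeros D.idealB ↔
      ∀ l m i j, D.evalB z l i * D.evalB z m j = D.evalB z l j * D.evalB z m i := by
  constructor
  · intro h
    exact (D.eval_idealB_iff z).mp (h z hz rfl)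
  · intro h z' hz' hzz'
    obtain ⟨c, rfl⟩ := (Projectivization.mk_eq_mk_iff' k _ _ _ _).mp hzz'
    rw [eval_idealB_iff, evalB_smul]
    intro l m i j
    simp only [Matrix.smul_apply, smul_eq_mul]
    linear_combination c ^ 2 * h l m i j

theorem mk_mem_biprojZeros_idealC_iff {z : Fin h₁ ⊕ Fin h₂ → k} (hz : z ≠ 0) {v : Fin n → k}
    (hv : v ≠ 0) : (Projectivization.mk k z hz, Projectivization.mk k v hv) ∈
      biprojZeros D.idealC ↔ D.ColProp z v := by
  constructor
  · intro h
    exact (D.eval_idealC_iff z hv).mp (h z hz v hv rfl rfl)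
  · intro h z' hz' v' hv' hzz' hvv'
    obtain ⟨c, rfl⟩ := (Projectivization.mk_eq_mk_iff' k _ _ _ _).mp hzz'
    obtain ⟨d, rfl⟩ := (Projectivization.mk_eq_mk_iff' k _ _ _ _).mp hvv'
    rw [D.eval_idealC_iff _ hv']
    intro l m j
    simp only [evalB_smul, Matrix.smul_apply, Pi.smul_apply, smul_eq_mul]
    linear_combination c * d * h l m j

/-- For n = 0 the ring R is k and I = 0, so I^⊥ is all of S and no nonzero z exists. -/
theorem nonempty_of_ne_zero (D : AdaptedBasis I t h₁ h₂) (hI : I ≠ ⊤) {z : Fin h₁ ⊕ Fin h₂ → k} (hz : z ≠ 0) :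
    Nonempty (Fin n) := by
  by_contra hn
  rw [not_nonempty_iff] at hn
  apply hz
  rw [← D.projFG_elt z, projFG_eq_zero_iff]
  intro f hf
  have hfm := IsLocalRing.le_maximalIdeal hI hf
  have hf0 : f = 0 := by
    ext θ
    rw [Subsingleton.elim θ 0]
    by_contra hne
    refine (IsLocalRing.mem_maximalIdeal f).mp hfm ?_
    rw [MvPowerSeries.isUnit_iff_constantCoeff]
    exact isUnit_iff_ne_zero.mpr hne
  rw [hf0, zero_smul]

/-- A nonzero column of B_H serves as v. If B_H = 0 any vector works, and a nonzero one exists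
because n > 0. -/
theorem exists_colProp (hI : I ≠ ⊤) {z : Fin h₁ ⊕ Fin h₂ → k} (hz : z ≠ 0)
    (h : ∀ l m i j, D.evalB z l i * D.evalB z m j = D.evalB z l j * D.evalB z m i) :
    ∃ v : Fin n → k, v ≠ 0 ∧ D.ColProp z v := by
  by_cases hB : D.evalB z = 0
  · obtain ⟨l⟩ := D.nonempty_of_ne_zero hI hz
    refine ⟨1, fun h1 => one_ne_zero (congrFun h1 l), fun l m j => ?_⟩
    simp [hB]
  · obtain ⟨l, j, hlj⟩ : ∃ l j, D.evalB z l j ≠ 0 := by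
      by_contra! h0
      exact hB (Matrix.ext h0)
    exact ⟨fun m => D.evalB z m j, fun h0 => hlj (congrFun h0 l), fun l m i => by
      rw [h l m i j, mul_comm]⟩

end AdaptedBasis

end MainTheorem

end GorensteinCover

/-! ### The equality of the two sets -/

theorem mainTheorem5 {k : Type*} [Field k] [IsAlgClosed k] {n : ℕ}
    (I : Ideal (GorensteinCover.PS n k)) [IsArtinianRing (GorensteinCover.PS n k ⧸ I)]
    (hI : I ≠ ⊤) (hgcl : 1 < GorensteinCover.gcl I)
    {t h₁ h₂ : ℕ} (D : GorensteinCover.AdaptedBasis I t h₁ h₂) :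
    D.MGC2 = GorensteinCover.projZeros D.idealB \
      Prod.fst '' (GorensteinCover.biprojZeros D.idealC ∩
        GorensteinCover.biprojZeros D.idealA) := by
  ext p
  constructor
  · rintro ⟨z, hz, rfl, hcov⟩
    obtain ⟨hker, hrank⟩ := (D.isCoverOfColength_poly_iff hI hz 2).mp hcov
    refine ⟨(D.mk_mem_projZeros_idealB_iff hz).mpr
      (GorensteinCover.mul_eq_mul_of_rank_le_one _ (by omega)), ?_⟩
    rintro ⟨⟨p, q⟩, ⟨hC, hA⟩, hp⟩
    obtain rfl : p = Projectivization.mk k z hz := hp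
    induction q using Projectivization.ind with
    | h v hv =>
      -- Colength exactly 2 means rank exactly 1, so the converse criterion for U applies to every
      -- admissible v.
      have hB : D.evalB z ≠ 0 := by
        intro h0
        rw [h0, Matrix.rank_zero] at hrank
        omega
      obtain ⟨f, hf, hne⟩ := (D.exists_eval_idealA_ne_zero_iff z v).mpr
        (D.span_evalU_eq_top hI hz hv ((D.mk_mem_biprojZeros_idealC_iff hz hv).mp hC) hB hker)
      exact hne (hA z hz v hv rfl rfl f hf)
  · rintro ⟨hB, hnot⟩
    induction p using Projectivization.ind with
    | h z hz =>
      rw [D.mk_mem_projZeros_idealB_iff hz] at hB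
      obtain ⟨v, hv, hvC⟩ := D.exists_colProp hI hz hB
      have hA : (Projectivization.mk k z hz, Projectivization.mk k v hv) ∉
          GorensteinCover.biprojZeros D.idealA := fun hA =>
        hnot ⟨_, ⟨(D.mk_mem_biprojZeros_idealC_iff hz hv).mpr hvC, hA⟩, rfl⟩
      simp only [GorensteinCover.biprojZeros, Set.mem_ofPred_eq, not_forall] at hA
      -- Zeros are tested on all representatives, so failure supplies some pair z', v' of the same
      -- two points; the argument continues with that pair.
      obtain ⟨z', hz', v', hv', hzz', hvv', f, hf, hne⟩ := hA
      have hC' : D.ColProp z' v' := by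
        rw [← D.mk_mem_biprojZeros_idealC_iff hz' hv', hzz', hvv',
          D.mk_mem_biprojZeros_idealC_iff hz hv]
        exact hvC
      have hker := D.ker_projFG_le_cyc hC'
        ((D.exists_eval_idealA_ne_zero_iff z' v').mp ⟨f, hf, hne⟩)
      have hcov := (D.isCoverOfColength_poly_iff hI hz' _).mpr ⟨hker, rfl⟩
      have hrank : (D.evalB z').rank ≤ 1 := by
        obtain ⟨w, hw⟩ := hC'.evalB_eq hv'
        rw [hw]
        exact Matrix.rank_vecMulVec_le v' w
      -- H is a cover of colength rank B_H + 1 ≤ 2; minimality of gcl(A) > 1 excludes rank 0.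
      have hgcl' : GorensteinCover.gcl I ≤ (D.evalB z').rank + 1 := Nat.sInf_le ⟨_, hcov⟩
      have h2 : (D.evalB z').rank + 1 = 2 := by omega
      rw [h2] at hcov
      exact ⟨z', hz', hzz', hcov⟩
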